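/- Let $\mathbb H$ be a separable real Hilbert space, $f\in\mathbb H$ and $\varepsilon>0$. One observes $Y(h)=\langle f,h\rangle+\varepsilon W(h)$, $h\in\mathbb H$, where $W$ is an isonormal process, i.e. a centered Gaussian process with $\mathbb E[W(g)W(h)]=\langle g,h\rangle$ for all $g,h\in\mathbb H$. Let $\mathcal D=\{\phi_j\}_{j\ge 1}\subset\mathbb H$ be an ordered dictionary with $\|\phi_j\|\le 1$ for all $j$, and assume that, almost surely, $W$ is linear on the linear span of $\mathcal D$ (every isonormal process has such a version). For $p\in\mathbb N^*=\{1,2,\dots\}$ let $\mathcal L_1(\mathcal D_p)$ be the linear span of $\mathcal D_p=\{\phi_1,\dots,\phi_p\}$, with $$\|h\|_{\mathcal L_1(\mathcal D_p)}=\inf\Big\{\sum_{j=1}^p|\theta_j| : \theta\in\mathbb R^p,\ h=\sum_{j=1}^p\theta_j\phi_j\Big\},$$ and let $\hat f_p$ be the Lasso estimator, which almost surely satisfies $$\hat f_p=\operatorname*{arg\,min}_{h\in\mathcal L_1(\mathcal D_p)}\Big(-2Y(h)+\|h\|^2+\lambda_p\|h\|_{\mathcal L_1(\mathcal D_p)}\Big),\qquad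 \lambda_p=4\varepsilon(\sqrt{\ln p}+1).$$ For $r>0$, an element $g\in\mathbb H$ belongs to $\mathcal L_{1,r}$ if there is $C>0$ such that for every $p\in\mathbb N^*$ there is $g_p\in\mathcal L_1(\mathcal D_p)$ with $\|g_p\|_{\mathcal L_1(\mathcal D_p)}\le C$ and $\|g-g_p\|\le C p^{-r}$; the infimum of these $C$ is denoted $\|g\|_{\mathcal L_{1,r}}$. For $1<q<2$ and $R>0$, $g\in\mathbb H$ belongs to $\mathcal B_{q,r}(R)$ if $$\inf_{h\in\mathcal L_{1,r}}\big(\|g-h\|+\delta\|h\|_{\mathcal L_{1,r}}\big)\le R\,\delta^{2(1/q-1/2)}\qquad\text{for all }\delta>0.$$ **Proposition.** Let $1<q<2$, $r>0$ and $R>0$, and assume that $f\in\mathcal B_{q,r}(R)$. Then there exists $C_q>0$ depending only on $q$ such that, for all $p\in\mathbb N^*$, $\|f-\hat f_p\|^2$ is integrable and: - if $(\sqrt{\ln p}+1)^{\frac{q-1}{q}}\le R\varepsilon^{-1}\le p^{\frac{2r}{q}}(\sqrt{\ln p}+1)$, then $$\mathbb E\big[\|f-\hat f_p\|^2\big]\le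 C_q\,R^q\big(\varepsilon(\sqrt{\ln p}+1)\big)^{2-q};$$ - if $R\varepsilon^{-1}>p^{\frac{2r}{q}}(\sqrt{\ln p}+1)$, then $$\mathbb E\big[\|f-\hat f_p\|^2\big]\le C_q\,(Rp^{-r})^{\frac{2q}{2-q}}\big(\varepsilon(\sqrt{\ln p}+1)\big)^{\frac{4(1-q)}{2-q}};$$ - if $R\varepsilon^{-1}<(\sqrt{\ln p}+1)^{\frac{q-1}{q}}$, then $$\mathbb E\big[\|f-\hat f_p\|^2\big]\le C_q\,\varepsilon^2(\sqrt{\ln p}+1).$$ -/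

import Mathlib

open MeasureTheory ProbabilityTheory

noncomputable section

/-- A centered Gaussian process `(W h)`, indexed by the Hilbert space `H`, is isonormal if its
covariance is the inner product of `H`. -/
structure IsIsonormal {H : Type*} [NormedAddCommGroup H] [InnerProductSpace ℝ H]
    {Ω : Type*} [MeasurableSpace Ω] (W : H → Ω → ℝ) (P : Measure Ω) : Prop where
  isGaussianProcess : IsGaussianProcess W P
  centered : ∀ h : H, ∫ ω, W h ω ∂P = 0
  covariance : ∀ g h : H, ∫ ω, W g ω * W h ω ∂P = inner ℝ g h

/-- The observed process `Y(h) = ⟨f, h⟩ + ε W(h)`. -/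
def observation {H : Type*} [NormedAddCommGroup H] [InnerProductSpace ℝ H] {Ω : Type*}
    (f : H) (ε : ℝ) (W : H → Ω → ℝ) (h : H) (ω : Ω) : ℝ :=
  inner ℝ f h + ε * W h ω

/-- The empirical least squares criterion `γ(h) = -2 Y(h) + ‖h‖²`. -/
def leastSquaresCrit {H : Type*} [NormedAddCommGroup H] {Ω : Type*}
    (Y : H → Ω → ℝ) (h : H) (ω : Ω) : ℝ :=
  -2 * Y h ω + ‖h‖ ^ 2

/-- The linear combination `θ.φ` of the first `p` elements of the dictionary. A dictionary
`φ₁, φ₂, …` is a sequence `φ : ℕ → H` in which `φ j` stands for the element number `j + 1`. -/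
def dictComb {H : Type*} [NormedAddCommGroup H] [InnerProductSpace ℝ H]
    (φ : ℕ → H) (p : ℕ) (θ : Fin p → ℝ) : H :=
  ∑ j : Fin p, θ j • φ j

/-- `L₁(D_p)`: the linear span of the truncated dictionary `D_p = {φ₁, …, φ_p}`. -/
def dictSpan {H : Type*} [NormedAddCommGroup H] [InnerProductSpace ℝ H]
    (φ : ℕ → H) (p : ℕ) : Set H :=
  {h | ∃ θ : Fin p → ℝ, h = dictComb φ p θ}

/-- The norm of `L₁(D_p)`: the infimum of `‖θ‖₁` over all representations `h = θ.φ`.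
(Only used for `h ∈ dictSpan φ p`.) -/
def dictNorm {H : Type*} [NormedAddCommGroup H] [InnerProductSpace ℝ H]
    (φ : ℕ → H) (p : ℕ) (h : H) : ℝ :=
  sInf {t : ℝ | ∃ θ : Fin p → ℝ, h = dictComb φ p θ ∧ t = ∑ j, |θ j|}

/-- The regularization parameter `λ_p = 4 ε (√(ln p) + 1)`. -/
def lassoParam (ε : ℝ) (p : ℕ) : ℝ :=
  4 * ε * (√(Real.log p) + 1)

/-- `fhat` is the Lasso estimator over the truncated dictionary `D_p`, with regularization
parameter `lam` and observations `Y`: almost surely, `fhat` minimizes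
`γ(h) + lam ‖h‖_{L₁(D_p)}` over `h ∈ L₁(D_p)`. -/
def IsLasso {H : Type*} [NormedAddCommGroup H] [InnerProductSpace ℝ H]
    {Ω : Type*} [MeasurableSpace Ω] (P : Measure Ω) (Y : H → Ω → ℝ)
    (φ : ℕ → H) (p : ℕ) (lam : ℝ) (fhat : Ω → H) : Prop :=
  ∀ᵐ ω ∂P, fhat ω ∈ dictSpan φ p ∧
    IsMinOn (fun h : H => leastSquaresCrit Y h ω + lam * dictNorm φ p h)
      (dictSpan φ p) (fhat ω)

/-- `C > 0` is an admissible constant in the definition of `L_{1,r}` for the element `g`. -/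
def IsL1rBound {H : Type*} [NormedAddCommGroup H] [InnerProductSpace ℝ H]
    (φ : ℕ → H) (r : ℝ) (g : H) (C : ℝ) : Prop :=
  0 < C ∧ ∀ p : ℕ, 1 ≤ p → ∃ gp ∈ dictSpan φ p,
    dictNorm φ p gp ≤ C ∧ ‖g - gp‖ ≤ C * (p : ℝ) ^ (-r)

/-- The space `L_{1,r}`. -/
def l1rSpace {H : Type*} [NormedAddCommGroup H] [InnerProductSpace ℝ H]
    (φ : ℕ → H) (r : ℝ) : Set H :=
  {g | ∃ C : ℝ, IsL1rBound φ r g C}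

/-- The norm of `L_{1,r}`: the smallest admissible constant.
(Only used for `g ∈ l1rSpace φ r`.) -/
def l1rNorm {H : Type*} [NormedAddCommGroup H] [InnerProductSpace ℝ H]
    (φ : ℕ → H) (r : ℝ) (g : H) : ℝ :=
  sInf {C : ℝ | IsL1rBound φ r g C}

/-- The class `B_{q,r}(R)`: for every `δ > 0`,
`inf_{h ∈ L_{1,r}} (‖g - h‖ + δ ‖h‖_{L_{1,r}}) ≤ R δ^{2α}` with `α = 1/q - 1/2`. -/
def interpClass {H : Type*} [NormedAddCommGroup H] [InnerProductSpace ℝ H]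
    (φ : ℕ → H) (q r R : ℝ) : Set H :=
  {g | ∀ δ : ℝ, 0 < δ →
    ⨅ h : l1rSpace φ r, (‖g - (h : H)‖ + δ * l1rNorm φ r (h : H)) ≤
      R * δ ^ (2 * (1 / q - 1 / 2))}

end

/-! The core is an oracle inequality (`lasso_oracle`): for every `h` in the span of `D_p`, the risk
is at most `3‖f - h‖² + 2λ_p‖h‖ + 64ε²`, with the dictionary norm in the middle term. Write `λ_p =
2εt`, `t = 2(√ln p + 1)`. If every `|W(φ_j)| ≤ t`, the noise term in the basic inequality is
absorbed by the penalty. Otherwise the noise is bounded by Cauchy–Schwarz in an orthonormal basis of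
the span, and the large squared coordinates are dominated by `noiseMajorant`, a sum of Gaussian
exponentials whose mean is at most 8 for this `t`.

The estimator is only an almost sure minimizer, so measurability of the loss must be proved: strong
convexity makes the estimator Lipschitz in finitely many noise coordinates, and the loss is then
almost surely a continuous function of them.

The rates follow by choosing `h`. Membership in the class gives, for each `δ ≥ p^{-r}`, some `h`
with `‖f - h‖ ≤ 2T` and norm at most `2T/δ`, where `T = Rδ^{2/q - 1}`. The regimes use the `δ`
balancing `T²` against `ε(√ln p + 1)T/δ`, then `δ = p^{-r}`, then simply `h = 0`. -/

/-! ### The span of the truncated dictionary, its norm, and linear noise paths -/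

section Dictionary

variable {H : Type*} [NormedAddCommGroup H] [InnerProductSpace ℝ H]

/-- The synthesis operator `θ ↦ θ.φ` as a linear map. -/
def dictMap (φ : ℕ → H) (p : ℕ) : (Fin p → ℝ) →ₗ[ℝ] H :=
  Fintype.linearCombination ℝ (fun j : Fin p => φ j)

lemma dictMap_apply (φ : ℕ → H) (p : ℕ) (θ : Fin p → ℝ) :
    dictMap φ p θ = dictComb φ p θ := by
  simp [dictMap, dictComb, Fintype.linearCombination_apply]

lemma mem_dictSpan_iff {φ : ℕ → H} {p : ℕ} {h : H} :
    h ∈ dictSpan φ p ↔ h ∈ LinearMap.range (dictMap φ p) := by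
  simp only [dictSpan, Set.mem_ofPred_eq, LinearMap.mem_range, dictMap_apply]
  exact exists_congr fun _ => eq_comm

lemma dict_mem_range (φ : ℕ → H) (p : ℕ) (j : Fin p) :
    φ j ∈ LinearMap.range (dictMap φ p) :=
  ⟨Pi.single j 1, by simp [dictMap]⟩

lemma dictNorm_bddBelow (φ : ℕ → H) (p : ℕ) (h : H) :
    BddBelow {t : ℝ | ∃ θ : Fin p → ℝ, h = dictComb φ p θ ∧ t = ∑ j, |θ j|} :=
  ⟨0, by rintro t ⟨θ, -, rfl⟩; positivity⟩

lemma dictNorm_nonneg (φ : ℕ → H) (p : ℕ) (h : H) : 0 ≤ dictNorm φ p h :=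
  Real.sInf_nonneg (by rintro t ⟨θ, -, rfl⟩; positivity)

lemma dictNorm_dictComb_le (φ : ℕ → H) (p : ℕ) (θ : Fin p → ℝ) :
    dictNorm φ p (dictComb φ p θ) ≤ ∑ j, |θ j| :=
  csInf_le (dictNorm_bddBelow φ p _) ⟨θ, rfl, rfl⟩

lemma exists_rep_lt {φ : ℕ → H} {p : ℕ} {h : H} (hh : h ∈ LinearMap.range (dictMap φ p))
    {η : ℝ} (hη : 0 < η) :
    ∃ θ : Fin p → ℝ, h = dictComb φ p θ ∧ ∑ j, |θ j| < dictNorm φ p h + η := by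
  obtain ⟨θ, hθ⟩ := hh
  obtain ⟨t, ⟨θ', h', rfl⟩, ht⟩ := exists_lt_of_csInf_lt
    (s := {t : ℝ | ∃ θ : Fin p → ℝ, h = dictComb φ p θ ∧ t = ∑ j, |θ j|})
    ⟨_, θ, by rw [← hθ, dictMap_apply], rfl⟩ (lt_add_of_pos_right (dictNorm φ p h) hη)
  exact ⟨θ', h', ht⟩

lemma dictNorm_zero (φ : ℕ → H) (p : ℕ) : dictNorm φ p 0 = 0 := by
  refine le_antisymm ?_ (dictNorm_nonneg φ p 0)
  have h := dictNorm_dictComb_le φ p 0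
  simpa [← dictMap_apply] using h

lemma dictNorm_midpoint_le {φ : ℕ → H} {p : ℕ} {g h : H}
    (hg : g ∈ LinearMap.range (dictMap φ p)) (hh : h ∈ LinearMap.range (dictMap φ p)) :
    dictNorm φ p ((1 / 2 : ℝ) • (g + h)) ≤ (dictNorm φ p g + dictNorm φ p h) / 2 := by
  refine le_of_forall_pos_le_add fun η hη => ?_
  obtain ⟨θ, rfl, hθ⟩ := exists_rep_lt hg hη
  obtain ⟨θ', rfl, hθ'⟩ := exists_rep_lt hh hη
  have h1 := dictNorm_dictComb_le φ p ((1 / 2 : ℝ) • (θ + θ'))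
  rw [← dictMap_apply, map_smul, map_add, dictMap_apply, dictMap_apply] at h1
  have h2 : ∑ j, |((1 / 2 : ℝ) • (θ + θ')) j| ≤ ∑ j, (|θ j| + |θ' j|) / 2 := by
    refine Finset.sum_le_sum fun j _ => ?_
    simp only [Pi.smul_apply, Pi.add_apply, smul_eq_mul, abs_mul]
    rw [abs_of_pos (by norm_num : (0 : ℝ) < 1 / 2)]
    linarith [abs_add_le (θ j) (θ' j)]
  rw [← Finset.sum_div, Finset.sum_add_distrib] at h2
  linarith

/-- The real function `w` is linear on the span of the first `p` dictionary elements. -/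
def IsLinearOnDict (φ : ℕ → H) (p : ℕ) (w : H → ℝ) : Prop :=
  ∀ θ : Fin p → ℝ, w (dictComb φ p θ) = ∑ j : Fin p, θ j * w (φ j)

variable {φ : ℕ → H} {p : ℕ} {w : H → ℝ}

lemma IsLinearOnDict.exists_linearMap (hw : IsLinearOnDict φ p w) :
    ∃ l : LinearMap.range (dictMap φ p) →ₗ[ℝ] ℝ, ∀ x, l x = w x := by
  have hadd : ∀ (a : ℝ) (x y : LinearMap.range (dictMap φ p)),
      w (a • (x : H) + y) = a * w x + w y := by
    rintro a ⟨_, θ, rfl⟩ ⟨_, θ', rfl⟩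
    simp only
    rw [← map_smul, ← map_add, dictMap_apply, dictMap_apply, dictMap_apply, hw, hw, hw,
      Finset.mul_sum, ← Finset.sum_add_distrib]
    refine Finset.sum_congr rfl fun j _ => ?_
    simp only [Pi.add_apply, Pi.smul_apply, smul_eq_mul]
    ring
  have h0 : w 0 = 0 := by simpa [← dictMap_apply] using hw 0
  refine ⟨{ toFun := fun x => w x, map_add' := fun x y => ?_, map_smul' := fun a x => ?_ },
    fun _ => rfl⟩
  · simpa using hadd 1 x y
  · simpa [h0] using hadd a x 0

lemma IsLinearOnDict.map_smul_add (hw : IsLinearOnDict φ p w) (a b : ℝ) {g h : H}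
    (hg : g ∈ LinearMap.range (dictMap φ p)) (hh : h ∈ LinearMap.range (dictMap φ p)) :
    w (a • g + b • h) = a * w g + b * w h := by
  obtain ⟨l, hl⟩ := hw.exists_linearMap
  have := map_add l (a • ⟨g, hg⟩) (b • ⟨h, hh⟩)
  rw [map_smul, map_smul, hl, hl, hl] at this
  simpa using this

lemma IsLinearOnDict.map_sub (hw : IsLinearOnDict φ p w) {g h : H}
    (hg : g ∈ LinearMap.range (dictMap φ p)) (hh : h ∈ LinearMap.range (dictMap φ p)) :
    w (g - h) = w g - w h := by
  have := hw.map_smul_add 1 (-1) hg hh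
  simpa [sub_eq_add_neg] using this

lemma IsLinearOnDict.abs_le_mul_dictNorm (hw : IsLinearOnDict φ p w) {M : ℝ} (hM0 : 0 ≤ M)
    (hM : ∀ j : Fin p, |w (φ j)| ≤ M) {g : H} (hg : g ∈ LinearMap.range (dictMap φ p)) :
    |w g| ≤ M * dictNorm φ p g := by
  refine le_of_forall_pos_le_add fun η hη => ?_
  -- Dividing by `M + 1` rather than `M` covers `M = 0`.
  obtain ⟨θ, h1, hθ⟩ := exists_rep_lt hg (η := η / (M + 1)) (by positivity)
  have h2 : |w g| ≤ ∑ j, |θ j| * M := by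
    rw [h1, hw]
    refine (Finset.abs_sum_le_sum_abs _ _).trans (Finset.sum_le_sum fun j _ => ?_)
    rw [abs_mul]
    exact mul_le_mul_of_nonneg_left (hM j) (abs_nonneg _)
  rw [← Finset.sum_mul] at h2
  have h3 : M * (η / (M + 1)) ≤ η := by
    rw [mul_div_assoc', div_le_iff₀ (by positivity)]
    nlinarith
  nlinarith [mul_le_mul_of_nonneg_left hθ.le hM0]

/-- An orthonormal basis of the span of the truncated dictionary. -/
noncomputable def dictBasis (φ : ℕ → H) (p : ℕ) :
    OrthonormalBasis (Fin (Module.finrank ℝ (LinearMap.range (dictMap φ p)))) ℝ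
      (LinearMap.range (dictMap φ p)) :=
  stdOrthonormalBasis ℝ _

lemma IsLinearOnDict.eq_sum_basis (hw : IsLinearOnDict φ p w) {g : H}
    (hg : g ∈ LinearMap.range (dictMap φ p)) :
    w g = ∑ i, inner ℝ (dictBasis φ p i : H) g * w (dictBasis φ p i) := by
  obtain ⟨l, hl⟩ := hw.exists_linearMap
  have h1 := congrArg l ((dictBasis φ p).sum_repr' ⟨g, hg⟩)
  rw [map_sum, hl] at h1
  rw [← h1]
  refine Finset.sum_congr rfl fun i _ => ?_
  rw [LinearMap.map_smul, hl]
  rfl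

lemma IsLinearOnDict.sq_le (hw : IsLinearOnDict φ p w) {g : H}
    (hg : g ∈ LinearMap.range (dictMap φ p)) :
    w g ^ 2 ≤ (∑ i, w (dictBasis φ p i) ^ 2) * ‖g‖ ^ 2 := by
  have h1 : ∑ i, inner ℝ (dictBasis φ p i : H) g ^ 2 = ‖g‖ ^ 2 := by
    have := (dictBasis φ p).sum_sq_norm_inner_right ⟨g, hg⟩
    simpa using this
  rw [hw.eq_sum_basis hg, mul_comm, ← h1]
  exact Finset.sum_mul_sq_le_sq_mul_sq _ _ _

end Dictionary

/-! ### Deterministic inequalities for a fixed noise path -/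

section Pathwise

variable {H : Type*} [NormedAddCommGroup H] [InnerProductSpace ℝ H]
  {φ : ℕ → H} {p : ℕ} {w : H → ℝ} {f fh h : H} {ε lam : ℝ}

/-- The penalized criterion along a path `w` of the noise, up to the constant `‖f‖²`. -/
noncomputable def lassoObjective (φ : ℕ → H) (p : ℕ) (f : H) (ε lam : ℝ) (w : H → ℝ) (h : H) : ℝ :=
  ‖f - h‖ ^ 2 - 2 * ε * w h + lam * dictNorm φ p h

lemma leastSquaresCrit_observation_add {Ω : Type*} (φ : ℕ → H) (p : ℕ) (f : H) (ε lam : ℝ)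
    (W : H → Ω → ℝ) (h : H) (ω : Ω) :
    leastSquaresCrit (observation f ε W) h ω + lam * dictNorm φ p h =
      lassoObjective φ p f ε lam (fun g => W g ω) h - ‖f‖ ^ 2 := by
  simp only [leastSquaresCrit, observation, lassoObjective]
  rw [norm_sub_sq_real]
  ring

lemma lasso_basic_inequality (hw : IsLinearOnDict φ p w)
    (hfh : fh ∈ LinearMap.range (dictMap φ p)) (hh : h ∈ LinearMap.range (dictMap φ p))
    (hmin : lassoObjective φ p f ε lam w fh ≤ lassoObjective φ p f ε lam w h) :
    ‖f - fh‖ ^ 2 + lam * dictNorm φ p fh ≤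
      ‖f - h‖ ^ 2 + lam * dictNorm φ p h + 2 * ε * w (fh - h) := by
  rw [hw.map_sub hfh hh]
  simp only [lassoObjective] at hmin
  linarith

/-- Duality bounds the noise at `fh - h` by `M` times the two dictionary norms; with `2εM = lam` the
`fh` part cancels against its penalty and the `h` part doubles the other one. -/
lemma lasso_le_of_abs_le (hw : IsLinearOnDict φ p w)
    (hfh : fh ∈ LinearMap.range (dictMap φ p)) (hh : h ∈ LinearMap.range (dictMap φ p))
    (hmin : lassoObjective φ p f ε lam w fh ≤ lassoObjective φ p f ε lam w h)
    (hε : 0 < ε) {M : ℝ} (hM0 : 0 ≤ M) (hM : ∀ j : Fin p, |w (φ j)| ≤ M)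
    (hlam : 2 * ε * M = lam) :
    ‖f - fh‖ ^ 2 ≤ ‖f - h‖ ^ 2 + 2 * lam * dictNorm φ p h := by
  have h1 := lasso_basic_inequality hw hfh hh hmin
  rw [hw.map_sub hfh hh] at h1
  have h2 := le_of_abs_le (hw.abs_le_mul_dictNorm hM0 hM hfh)
  have h3 := neg_le_of_abs_le (hw.abs_le_mul_dictNorm hM0 hM hh)
  have h4 : 2 * ε * (w fh - w h) ≤ 2 * ε * (M * dictNorm φ p fh + M * dictNorm φ p h) :=
    mul_le_mul_of_nonneg_left (by linarith) (by positivity)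
  subst hlam
  linarith

lemma lasso_le_of_sq_le (hw : IsLinearOnDict φ p w)
    (hfh : fh ∈ LinearMap.range (dictMap φ p)) (hh : h ∈ LinearMap.range (dictMap φ p))
    (hmin : lassoObjective φ p f ε lam w fh ≤ lassoObjective φ p f ε lam w h)
    (hε : 0 < ε) (hlam : 0 ≤ lam) :
    ‖f - fh‖ ^ 2 ≤ 3 * ‖f - h‖ ^ 2 + 2 * lam * dictNorm φ p h +
      8 * ε ^ 2 * ∑ i, w (dictBasis φ p i) ^ 2 := by
  have h1 := lasso_basic_inequality hw hfh hh hmin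
  have h2 := hw.sq_le (Submodule.sub_mem _ hfh hh)
  have h3 := mul_nonneg hlam (dictNorm_nonneg φ p fh)
  set S := ∑ i, w (dictBasis φ p i) ^ 2
  have hS : 0 ≤ S := by positivity
  have h4 : |w (fh - h)| ≤ √S * ‖fh - h‖ := by
    refine abs_le_of_sq_le_sq ?_ (by positivity)
    rwa [mul_pow, Real.sq_sqrt hS]
  have h5 : ‖fh - h‖ ≤ ‖f - fh‖ + ‖f - h‖ := by
    rw [← norm_neg (f - fh)]
    calc ‖fh - h‖ = ‖-(f - fh) + (f - h)‖ := by congr 1; abel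
      _ ≤ _ := norm_add_le _ _
  have h6 : 2 * ε * w (fh - h) ≤ 2 * (ε * √S) * (‖f - fh‖ + ‖f - h‖) := by
    have := mul_le_mul_of_nonneg_left ((le_of_abs_le h4).trans
      (mul_le_mul_of_nonneg_left h5 (Real.sqrt_nonneg S))) (by positivity : 0 ≤ 2 * ε)
    linarith
  have h7 : (ε * √S) ^ 2 = ε ^ 2 * S := by rw [mul_pow, Real.sq_sqrt hS]
  -- Young's inequality `2sx ≤ x²/2 + 2s²` with `s = ε√S`, once for each distance; half of `‖f -
  -- fh‖²` moves to the left.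
  nlinarith [sq_nonneg (‖f - fh‖ - 2 * (ε * √S)), sq_nonneg (‖f - h‖ - 2 * (ε * √S))]

lemma lassoObjective_midpoint_le (hw : IsLinearOnDict φ p w)
    (hfh : fh ∈ LinearMap.range (dictMap φ p)) (hh : h ∈ LinearMap.range (dictMap φ p))
    (hlam : 0 ≤ lam) :
    lassoObjective φ p f ε lam w ((1 / 2 : ℝ) • (fh + h)) + ‖fh - h‖ ^ 2 / 4 ≤
      (lassoObjective φ p f ε lam w fh + lassoObjective φ p f ε lam w h) / 2 := by
  have h1 := mul_le_mul_of_nonneg_left (dictNorm_midpoint_le hfh hh) hlam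
  have h2 := hw.map_smul_add (1 / 2) (1 / 2) hfh hh
  rw [← smul_add] at h2
  -- The parallelogram law, which supplies the strong convexity.
  have h3 : ‖f - (1 / 2 : ℝ) • (fh + h)‖ ^ 2 + ‖fh - h‖ ^ 2 / 4 =
      (‖f - fh‖ ^ 2 + ‖f - h‖ ^ 2) / 2 := by
    have e1 : f - (1 / 2 : ℝ) • (fh + h) = (1 / 2 : ℝ) • ((f - fh) + (f - h)) := by
      module
    have e2 : fh - h = (f - h) - (f - fh) := by abel
    rw [e1, e2, norm_smul, mul_pow]
    generalize f - fh = x, f - h = y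
    rw [norm_add_sq_real, norm_sub_sq_real, real_inner_comm x y]
    norm_num
    ring
  simp only [lassoObjective]
  rw [h2]
  linarith

/-- Quadratic growth at a minimizer, from comparison with the midpoint. -/
lemma lassoObjective_add_le_of_isMinOn (hw : IsLinearOnDict φ p w)
    (hfh : fh ∈ LinearMap.range (dictMap φ p)) (hh : h ∈ LinearMap.range (dictMap φ p))
    (hlam : 0 ≤ lam) (hmin : ∀ g ∈ LinearMap.range (dictMap φ p),
      lassoObjective φ p f ε lam w fh ≤ lassoObjective φ p f ε lam w g) :
    lassoObjective φ p f ε lam w fh + ‖fh - h‖ ^ 2 / 2 ≤ lassoObjective φ p f ε lam w h := by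
  have h1 := lassoObjective_midpoint_le (f := f) (ε := ε) hw hfh hh hlam
  have h2 := hmin _ (Submodule.smul_mem _ (1 / 2 : ℝ) (Submodule.add_mem _ hfh hh))
  linarith

/-- The Lasso estimator depends in a Lipschitz way on the coordinates of the noise. -/
lemma norm_sub_le_of_isMinOn {w' : H → ℝ} {fh' : H} (hw : IsLinearOnDict φ p w)
    (hw' : IsLinearOnDict φ p w') (hfh : fh ∈ LinearMap.range (dictMap φ p))
    (hfh' : fh' ∈ LinearMap.range (dictMap φ p)) (hε : 0 < ε) (hlam : 0 ≤ lam)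
    (hmin : ∀ g ∈ LinearMap.range (dictMap φ p),
      lassoObjective φ p f ε lam w fh ≤ lassoObjective φ p f ε lam w g)
    (hmin' : ∀ g ∈ LinearMap.range (dictMap φ p),
      lassoObjective φ p f ε lam w' fh' ≤ lassoObjective φ p f ε lam w' g) :
    ‖fh - fh'‖ ≤ 2 * ε * Module.finrank ℝ (LinearMap.range (dictMap φ p)) *
      dist (fun i => w (dictBasis φ p i)) (fun i => w' (dictBasis φ p i)) := by
  have h1 := lassoObjective_add_le_of_isMinOn hw hfh hfh' hlam hmin
  have h2 := lassoObjective_add_le_of_isMinOn hw' hfh' hfh hlam hmin'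
  rw [norm_sub_rev fh' fh] at h2
  have hd := Submodule.sub_mem _ hfh hfh'
  -- Adding the two growth inequalities cancels every fit and penalty term; only the difference of
  -- the noises remains.
  have h3 : ‖fh - fh'‖ ^ 2 ≤ 2 * ε * (w (fh - fh') - w' (fh - fh')) := by
    rw [hw.map_sub hfh hfh', hw'.map_sub hfh hfh']
    simp only [lassoObjective] at h1 h2
    linarith
  set D := dist (fun i => w (dictBasis φ p i)) (fun i => w' (dictBasis φ p i))
  have h4 : w (fh - fh') - w' (fh - fh') ≤
      Module.finrank ℝ (LinearMap.range (dictMap φ p)) * (‖fh - fh'‖ * D) := by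
    rw [hw.eq_sum_basis hd, hw'.eq_sum_basis hd, ← Finset.sum_sub_distrib]
    -- The distance on coordinates is the sup distance, hence the factor `finrank`.
    refine (Finset.sum_le_card_nsmul _ _ (‖fh - fh'‖ * D) fun i _ => ?_).trans_eq (by simp)
    rw [← mul_sub]
    refine (le_abs_self _).trans ?_
    rw [abs_mul]
    have hb : ‖(dictBasis φ p i : H)‖ = 1 := (dictBasis φ p).norm_eq_one i
    gcongr
    · simpa [hb] using abs_real_inner_le_norm (dictBasis φ p i : H) (fh - fh')
    · exact dist_le_pi_dist (fun i => w (dictBasis φ p i)) (fun i => w' (dictBasis φ p i)) i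
  rcases (norm_nonneg (fh - fh')).eq_or_lt with h0 | h0
  · rw [← h0]; positivity
  · have h5 := h3.trans (mul_le_mul_of_nonneg_left h4 (by positivity : 0 ≤ 2 * ε))
    refine le_of_mul_le_mul_right ?_ h0
    linarith

end Pathwise

/-! ### Exponential moments of the isonormal process -/

section Isonormal

variable {H : Type*} [NormedAddCommGroup H] [InnerProductSpace ℝ H]
  {Ω : Type*} [MeasurableSpace Ω] {P : Measure Ω} {W : H → Ω → ℝ}

lemma IsIsonormal.mgf_one (hW : IsIsonormal W P) (g : H) :
    mgf (W g) P 1 = Real.exp (‖g‖ ^ 2 / 2) := by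
  have hg := hW.isGaussianProcess.hasGaussianLaw_eval g
  have hvar : Var[W g; P] = ‖g‖ ^ 2 := by
    rw [variance_of_integral_eq_zero hg.aemeasurable (hW.centered g), ← real_inner_self_eq_norm_sq,
      ← hW.covariance g g]
    simp only [sq]
  rw [mgf_gaussianReal hg.map_eq_gaussianReal, hW.centered g, hvar,
    Real.coe_toNNReal _ (by positivity)]
  simp

lemma IsIsonormal.integral_exp (hW : IsIsonormal W P) (g : H) :
    ∫ ω, Real.exp (W g ω) ∂P = Real.exp (‖g‖ ^ 2 / 2) := by
  simpa [mgf] using hW.mgf_one g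

lemma IsIsonormal.integrable_exp (hW : IsIsonormal W P) (g : H) :
    Integrable (fun ω => Real.exp (W g ω)) P :=
  -- A nonzero Bochner integral forces integrability.
  Integrable.of_integral_ne_zero (by rw [hW.integral_exp g]; positivity)

end Isonormal

/-- Comes from `x² ≤ 4 sinh²(x/2) = 2 cosh x - 2`. -/
lemma sq_le_exp_add_exp_neg (x : ℝ) : x ^ 2 ≤ Real.exp x + Real.exp (-x) := by
  have h1 := Real.cosh_sq (x / 2)
  have h2 : (x / 2) ^ 2 ≤ Real.sinh (x / 2) ^ 2 := by
    rw [sq_le_sq, Real.abs_sinh]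
    exact Real.self_le_sinh_iff.2 (abs_nonneg _)
  have h3 := Real.cosh_two_mul (x / 2)
  rw [mul_div_cancel₀ x two_ne_zero, Real.cosh_eq] at h3
  nlinarith

lemma one_le_exp_mul_of_lt_abs {t y : ℝ} (ht : 0 ≤ t) (hy : t < |y|) :
    1 ≤ Real.exp (-t ^ 2) * (Real.exp (t * y) + Real.exp (-(t * y))) := by
  have h1 : Real.exp (t ^ 2) ≤ Real.exp (t * y) + Real.exp (-(t * y)) := by
    have h2 : t ^ 2 ≤ |t * y| := by
      rw [abs_mul, abs_of_nonneg ht, sq]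
      exact mul_le_mul_of_nonneg_left hy.le ht
    rcases abs_choice (t * y) with h | h <;> rw [h] at h2
    · linarith [Real.exp_le_exp.2 h2, Real.exp_pos (-(t * y))]
    · linarith [Real.exp_le_exp.2 h2, Real.exp_pos (t * y)]
  calc (1 : ℝ) = Real.exp (-t ^ 2) * Real.exp (t ^ 2) := by rw [← Real.exp_add]; simp
    _ ≤ _ := by gcongr

/-! ### Controlling the noise when some coordinate is large -/

section Noise

variable {H : Type*} [NormedAddCommGroup H] [InnerProductSpace ℝ H]

/-- An integrable majorant of `w(e)² 1_{|w(u)| > t}` for a linear path `w`. -/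
noncomputable def expMajorant (t : ℝ) (e u : H) (w : H → ℝ) : ℝ :=
  Real.exp (-t ^ 2) *
    (Real.exp (w ((1 : ℝ) • e + t • u)) + Real.exp (w ((1 : ℝ) • e + (-t) • u)) +
      Real.exp (w ((-1 : ℝ) • e + t • u)) + Real.exp (w ((-1 : ℝ) • e + (-t) • u)))

/-- A majorant of the squared noise on the event where some coordinate exceeds `t`. -/
noncomputable def noiseMajorant (φ : ℕ → H) (p : ℕ) (t : ℝ) (w : H → ℝ) : ℝ :=
  ∑ i, ∑ j : Fin p, expMajorant t (dictBasis φ p i : H) (φ j) w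

lemma expMajorant_nonneg (t : ℝ) (e u : H) (w : H → ℝ) : 0 ≤ expMajorant t e u w := by
  unfold expMajorant; positivity

lemma noiseMajorant_nonneg (φ : ℕ → H) (p : ℕ) (t : ℝ) (w : H → ℝ) :
    0 ≤ noiseMajorant φ p t w :=
  Finset.sum_nonneg fun _ _ => Finset.sum_nonneg fun _ _ => expMajorant_nonneg _ _ _ _

variable {φ : ℕ → H} {p : ℕ} {w : H → ℝ}

/-- Bound the square by exponentials of `±w e` and the indicator by the Chernoff factor in `w u`.
Linearity of the path merges each product into one exponential of a Gaussian variable, so no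
independence is needed. -/
lemma IsLinearOnDict.sq_le_expMajorant (hw : IsLinearOnDict φ p w) {t : ℝ} (ht : 0 ≤ t)
    {e u : H} (he : e ∈ LinearMap.range (dictMap φ p)) (hu : u ∈ LinearMap.range (dictMap φ p))
    (hwu : t < |w u|) : w e ^ 2 ≤ expMajorant t e u w := by
  unfold expMajorant
  have h1 := one_le_exp_mul_of_lt_abs ht hwu
  have h2 := sq_le_exp_add_exp_neg (w e)
  have h3 := mul_le_mul h2 h1 zero_le_one (by positivity)
  simp only [hw.map_smul_add _ _ he hu, Real.exp_add, one_mul, neg_mul]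
  calc w e ^ 2 = w e ^ 2 * 1 := (mul_one _).symm
    _ ≤ _ := h3
    _ = _ := by ring

lemma IsLinearOnDict.sum_sq_le_noiseMajorant (hw : IsLinearOnDict φ p w) {t : ℝ} (ht : 0 ≤ t)
    {j : Fin p} (hj : t < |w (φ j)|) :
    ∑ i, w (dictBasis φ p i) ^ 2 ≤ noiseMajorant φ p t w := by
  refine Finset.sum_le_sum fun i _ => ?_
  exact (hw.sq_le_expMajorant ht (dictBasis φ p i).2 (dict_mem_range φ p j) hj).trans
    (Finset.single_le_sum (f := fun j : Fin p => expMajorant t (dictBasis φ p i : H) (φ j) w)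
      (fun _ _ => expMajorant_nonneg _ _ _ _) (Finset.mem_univ j))

lemma lasso_le_noiseMajorant {f fh h : H} {ε t : ℝ} (hw : IsLinearOnDict φ p w)
    (hfh : fh ∈ LinearMap.range (dictMap φ p)) (hh : h ∈ LinearMap.range (dictMap φ p))
    (hε : 0 < ε) (ht : 0 ≤ t)
    (hmin : lassoObjective φ p f ε (2 * ε * t) w fh ≤ lassoObjective φ p f ε (2 * ε * t) w h) :
    ‖f - fh‖ ^ 2 ≤ 3 * ‖f - h‖ ^ 2 + 2 * (2 * ε * t) * dictNorm φ p h +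
      8 * ε ^ 2 * noiseMajorant φ p t w := by
  -- The majorant is nonnegative, so one bound covers both cases and the exceptional event needs no
  -- separate integration.
  by_cases hj : ∃ j : Fin p, t < |w (φ j)|
  · obtain ⟨j, hj⟩ := hj
    have h1 := lasso_le_of_sq_le hw hfh hh hmin hε (by positivity)
    have h2 := mul_le_mul_of_nonneg_left (hw.sum_sq_le_noiseMajorant ht hj)
      (by positivity : 0 ≤ 8 * ε ^ 2)
    linarith
  · push Not at hj
    have h1 := lasso_le_of_abs_le hw hfh hh hmin hε ht hj rfl
    have h2 := mul_nonneg (by positivity : 0 ≤ 8 * ε ^ 2) (noiseMajorant_nonneg φ p t w)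
    nlinarith [sq_nonneg ‖f - h‖]

variable {Ω : Type*} [MeasurableSpace Ω] {P : Measure Ω} {W : H → Ω → ℝ}

lemma IsIsonormal.integrable_expMajorant (hW : IsIsonormal W P) (t : ℝ) (e u : H) :
    Integrable (fun ω => expMajorant t e u (fun g => W g ω)) P :=
  ((((hW.integrable_exp _).add (hW.integrable_exp _)).add (hW.integrable_exp _)).add
    (hW.integrable_exp _)).const_mul _

lemma IsIsonormal.integral_expMajorant_le (hW : IsIsonormal W P) {t : ℝ} (ht : 0 ≤ t) {e u : H}
    (he : ‖e‖ ≤ 1) (hu : ‖u‖ ≤ 1) :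
    ∫ ω, expMajorant t e u (fun g => W g ω) ∂P ≤ 4 * Real.exp (-t ^ 2 + (1 + t) ^ 2 / 2) := by
  have key : ∀ a b : ℝ, |a| = 1 → |b| = t →
      ∫ ω, Real.exp (W (a • e + b • u) ω) ∂P ≤ Real.exp ((1 + t) ^ 2 / 2) := by
    intro a b ha hb
    rw [hW.integral_exp, Real.exp_le_exp]
    have : ‖a • e + b • u‖ ≤ 1 + t := by
      refine (norm_add_le _ _).trans ?_
      rw [norm_smul, norm_smul, Real.norm_eq_abs, Real.norm_eq_abs, ha, hb]
      nlinarith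
    gcongr
  unfold expMajorant
  rw [integral_const_mul, integral_add, integral_add, integral_add, Real.exp_add]
  · have h1 := key 1 t (by simp) (abs_of_nonneg ht)
    have h2 := key 1 (-t) (by simp) (by rw [abs_neg, abs_of_nonneg ht])
    have h3 := key (-1) t (by simp) (abs_of_nonneg ht)
    have h4 := key (-1) (-t) (by simp) (by rw [abs_neg, abs_of_nonneg ht])
    rw [mul_left_comm]
    refine mul_le_mul_of_nonneg_left ?_ (Real.exp_nonneg _)
    linarith
  all_goals first
    | exact hW.integrable_exp _
    | exact (hW.integrable_exp _).add (hW.integrable_exp _)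
    | exact ((hW.integrable_exp _).add (hW.integrable_exp _)).add (hW.integrable_exp _)

lemma IsIsonormal.integrable_noiseMajorant (hW : IsIsonormal W P) (φ : ℕ → H) (p : ℕ) (t : ℝ) :
    Integrable (fun ω => noiseMajorant φ p t (fun g => W g ω)) P :=
  integrable_finsetSum _ fun _ _ => integrable_finsetSum _ fun _ _ =>
    hW.integrable_expMajorant _ _ _

lemma exp_threshold_le {p : ℕ} (hp : 1 ≤ p) :
    4 * Real.exp (-(2 * (√(Real.log p) + 1)) ^ 2 + (1 + 2 * (√(Real.log p) + 1)) ^ 2 / 2) ≤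
      8 / (p : ℝ) ^ 2 := by
  have hp0 : (0 : ℝ) < p := by exact_mod_cast hp
  have hlog : 0 ≤ Real.log p := Real.log_natCast_nonneg p
  have h1 := Real.sq_sqrt hlog
  -- With `x = √ln p` the left side equals `1/2 - 2x² - 2x`. The resulting `p⁻²` pays for the double
  -- sum over at most `p` basis vectors and `p` dictionary elements.
  have h2 : -(2 * (√(Real.log p) + 1)) ^ 2 + (1 + 2 * (√(Real.log p) + 1)) ^ 2 / 2 ≤
      1 / 2 + (-Real.log p + -Real.log p) := by
    nlinarith [Real.sqrt_nonneg (Real.log p)]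
  have h3 : Real.exp (1 / 2) ≤ 2 := by
    rw [← Real.le_log_iff_exp_le (by norm_num)]
    linarith [Real.log_two_gt_d9]
  have h4 := Real.exp_le_exp.2 h2
  rw [Real.exp_add (1 / 2), Real.exp_add (-Real.log p), Real.exp_neg (Real.log p),
    Real.exp_log hp0] at h4
  have h5 : Real.exp (1 / 2) * ((p : ℝ)⁻¹ * (p : ℝ)⁻¹) ≤ 2 * ((p : ℝ)⁻¹ * (p : ℝ)⁻¹) := by
    gcongr
  calc _ ≤ 4 * (2 * ((p : ℝ)⁻¹ * (p : ℝ)⁻¹)) := by linarith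
    _ = _ := by field_simp; norm_num

lemma IsIsonormal.integral_noiseMajorant_le (hW : IsIsonormal W P) (hφ : ∀ j, ‖φ j‖ ≤ 1)
    (hp : 1 ≤ p) :
    ∫ ω, noiseMajorant φ p (2 * (√(Real.log p) + 1)) (fun g => W g ω) ∂P ≤ 8 := by
  have hp0 : (0 : ℝ) < p := by exact_mod_cast hp
  unfold noiseMajorant
  rw [integral_finsetSum _ fun _ _ => integrable_finsetSum _ fun _ _ =>
    hW.integrable_expMajorant _ _ _]
  have h1 : ∀ i, ∫ ω, ∑ j : Fin p, expMajorant (2 * (√(Real.log p) + 1))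
      (dictBasis φ p i : H) (φ j) (fun g => W g ω) ∂P ≤ 8 / p := by
    intro i
    rw [integral_finsetSum _ fun _ _ => hW.integrable_expMajorant _ _ _]
    refine (Finset.sum_le_card_nsmul _ _ (8 / (p : ℝ) ^ 2) fun j _ => ?_).trans_eq ?_
    · exact (hW.integral_expMajorant_le (by positivity)
        ((dictBasis φ p).norm_eq_one i).le (hφ j)).trans (exp_threshold_le hp)
    · simp only [Finset.card_univ, Fintype.card_fin, nsmul_eq_mul]
      field_simp
  refine (Finset.sum_le_card_nsmul _ _ (8 / (p : ℝ)) fun i _ => h1 i).trans ?_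
  have h2 : (Module.finrank ℝ (LinearMap.range (dictMap φ p)) : ℝ) ≤ p := by
    have := LinearMap.finrank_range_le (dictMap φ p)
    rw [Module.finrank_fin_fun] at this
    exact_mod_cast this
  simp only [Finset.card_univ, Fintype.card_fin, nsmul_eq_mul]
  calc _ ≤ (p : ℝ) * (8 / p) := by gcongr
    _ = 8 := by field_simp

end Noise

/-! ### Factoring through finitely many coordinates -/

section Measurability

/-- The bound makes `u` constant on the fibres of `X` in `s`, so it descends to a Lipschitz function
on `X '' s`, which extends to all of `E`. -/
lemma exists_lipschitz_factor {Ω E : Type*} [PseudoMetricSpace E] {s : Set Ω} {X : Ω → E}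
    {u : Ω → ℝ} {c : ℝ} (hc : 0 ≤ c)
    (h : ∀ a ∈ s, ∀ b ∈ s, |u a - u b| ≤ c * dist (X a) (X b)) :
    ∃ g : E → ℝ, Continuous g ∧ ∀ a ∈ s, u a = g (X a) := by
  rcases s.eq_empty_or_nonempty with rfl | ⟨a₀, ha₀⟩
  · exact ⟨0, continuous_zero, by simp⟩
  have : Nonempty Ω := ⟨a₀⟩
  have hinv : ∀ x ∈ X '' s, Function.invFunOn X s x ∈ s ∧ X (Function.invFunOn X s x) = x :=
    fun x hx => ⟨Function.invFunOn_mem hx, Function.invFunOn_eq hx⟩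
  have hL : LipschitzOnWith ⟨c, hc⟩ (fun x => u (Function.invFunOn X s x)) (X '' s) := by
    refine LipschitzOnWith.of_dist_le_mul fun x hx y hy => ?_
    have := h _ (hinv x hx).1 _ (hinv y hy).1
    rwa [(hinv x hx).2, (hinv y hy).2] at this
  obtain ⟨g, hg, hgs⟩ := hL.extend_real
  refine ⟨g, hg.continuous, fun a ha => ?_⟩
  have hXa : X a ∈ X '' s := ⟨a, ha, rfl⟩
  rw [← hgs hXa]
  have h1 := h a ha _ (hinv _ hXa).1
  rw [(hinv _ hXa).2, dist_self, mul_zero] at h1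
  exact sub_eq_zero.1 (abs_nonpos_iff.1 h1)

end Measurability

/-! ### The oracle inequality -/

section Oracle

variable {H : Type*} [NormedAddCommGroup H] [InnerProductSpace ℝ H]
  {Ω : Type*} [MeasurableSpace Ω] {P : Measure Ω} {W : H → Ω → ℝ}
  {φ : ℕ → H} {p : ℕ} {f : H} {ε lam : ℝ} {fhat : Ω → H}

lemma IsLasso.ae_isMin (h : IsLasso P (observation f ε W) φ p lam fhat) :
    ∀ᵐ ω ∂P, fhat ω ∈ LinearMap.range (dictMap φ p) ∧
      ∀ g ∈ LinearMap.range (dictMap φ p),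
        lassoObjective φ p f ε lam (fun g => W g ω) (fhat ω) ≤
          lassoObjective φ p f ε lam (fun g => W g ω) g := by
  filter_upwards [h] with ω hω
  refine ⟨mem_dictSpan_iff.1 hω.1, fun g hg => ?_⟩
  have := isMinOn_iff.1 hω.2 g (mem_dictSpan_iff.2 hg)
  rw [leastSquaresCrit_observation_add, leastSquaresCrit_observation_add] at this
  linarith

lemma IsLasso.aemeasurable_norm (h : IsLasso P (observation f ε W) φ p lam fhat)
    (hW : IsIsonormal W P) (hlin : ∀ᵐ ω ∂P, IsLinearOnDict φ p (fun g => W g ω))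
    (hε : 0 < ε) (hlam : 0 ≤ lam) :
    AEMeasurable (fun ω => ‖f - fhat ω‖) P := by
  have hae := h.ae_isMin.and hlin
  obtain ⟨g, hg, hgs⟩ := exists_lipschitz_factor
    (s := {ω | (fhat ω ∈ LinearMap.range (dictMap φ p) ∧
      ∀ g ∈ LinearMap.range (dictMap φ p),
        lassoObjective φ p f ε lam (fun g => W g ω) (fhat ω) ≤
          lassoObjective φ p f ε lam (fun g => W g ω) g) ∧
      IsLinearOnDict φ p (fun g => W g ω)})
    (X := fun ω i => W (dictBasis φ p i) ω) (u := fun ω => ‖f - fhat ω‖)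
    (c := 2 * ε * Module.finrank ℝ (LinearMap.range (dictMap φ p))) (by positivity)
    (fun a ha b hb => by
      refine le_trans ?_ (norm_sub_le_of_isMinOn ha.2 hb.2 ha.1.1 hb.1.1 hε hlam ha.1.2 hb.1.2)
      rw [norm_sub_rev (fhat a)]
      simpa using abs_norm_sub_norm_le (f - fhat a) (f - fhat b))
  have hX : AEMeasurable (fun ω i => W (dictBasis φ p i) ω) P :=
    aemeasurable_pi_lambda _ fun i => hW.isGaussianProcess.aemeasurable _
  refine (hg.measurable.comp_aemeasurable hX).congr ?_
  filter_upwards [hae] with ω hω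
  exact (hgs ω hω).symm

/-- Oracle inequality for the Lasso, with integrability of the squared loss. -/
theorem lasso_oracle [IsProbabilityMeasure P] (hW : IsIsonormal W P)
    (hlin : ∀ᵐ ω ∂P, IsLinearOnDict φ p (fun g => W g ω)) (hφ : ∀ j, ‖φ j‖ ≤ 1)
    (hε : 0 < ε) (hp : 1 ≤ p)
    (hL : IsLasso P (observation f ε W) φ p (lassoParam ε p) fhat) :
    Integrable (fun ω => ‖f - fhat ω‖ ^ 2) P ∧
      ∀ h ∈ LinearMap.range (dictMap φ p),
        ∫ ω, ‖f - fhat ω‖ ^ 2 ∂P ≤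
          3 * ‖f - h‖ ^ 2 + 2 * lassoParam ε p * dictNorm φ p h + 64 * ε ^ 2 := by
  have hlam : lassoParam ε p = 2 * ε * (2 * (√(Real.log p) + 1)) := by
    unfold lassoParam; ring
  have hbound : ∀ h ∈ LinearMap.range (dictMap φ p), ∀ᵐ ω ∂P, ‖f - fhat ω‖ ^ 2 ≤
      3 * ‖f - h‖ ^ 2 + 2 * lassoParam ε p * dictNorm φ p h +
        8 * ε ^ 2 * noiseMajorant φ p (2 * (√(Real.log p) + 1)) (fun g => W g ω) := by
    intro h hh
    filter_upwards [hL.ae_isMin, hlin] with ω hω hωl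
    have := hω.2 h hh
    rw [hlam] at this ⊢
    exact lasso_le_noiseMajorant hωl hω.1 hh hε (by positivity) this
  have hmaj : Integrable (fun ω => 8 * ε ^ 2 *
      noiseMajorant φ p (2 * (√(Real.log p) + 1)) (fun g => W g ω)) P :=
    (hW.integrable_noiseMajorant φ p _).const_mul _
  have hint : Integrable (fun ω => ‖f - fhat ω‖ ^ 2) P := by
    -- The comparison element `h = 0` already gives an integrable majorant.
    refine (((integrable_const (3 * ‖f - 0‖ ^ 2 + 2 * lassoParam ε p * dictNorm φ p 0)).add
      hmaj)).mono'
      ((hL.aemeasurable_norm hW hlin hε (by unfold lassoParam; positivity)).pow_const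
        2).aestronglyMeasurable ?_
    filter_upwards [hbound 0 (Submodule.zero_mem _)] with ω hω
    rw [Real.norm_of_nonneg (by positivity)]
    exact hω
  refine ⟨hint, fun h hh => ?_⟩
  refine (integral_mono_ae hint ((integrable_const _).add hmaj) (hbound h hh)).trans ?_
  simp only [Pi.add_apply]
  rw [integral_add (integrable_const _) hmaj, integral_const_mul, integral_const]
  have h1 := mul_le_mul_of_nonneg_left (hW.integral_noiseMajorant_le hφ hp)
    (by positivity : 0 ≤ 8 * ε ^ 2)
  simp only [probReal_univ, one_smul]
  linarith

end Oracle

/-! ### Approximating elements of the interpolation class -/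

section Approximation

variable {H : Type*} [NormedAddCommGroup H] [InnerProductSpace ℝ H] {φ : ℕ → H} {p : ℕ}

lemma norm_le_dictNorm (hφ : ∀ j, ‖φ j‖ ≤ 1) {h : H} (hh : h ∈ LinearMap.range (dictMap φ p)) :
    ‖h‖ ≤ dictNorm φ p h := by
  refine le_of_forall_pos_le_add fun η hη => ?_
  obtain ⟨θ, h1, hθ⟩ := exists_rep_lt hh hη
  refine le_trans ?_ hθ.le
  rw [h1]
  refine (norm_sum_le _ _).trans (Finset.sum_le_sum fun j _ => ?_)
  rw [norm_smul, Real.norm_eq_abs]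
  exact mul_le_of_le_one_right (abs_nonneg _) (hφ j)

lemma zero_mem_l1rSpace (φ : ℕ → H) (r : ℝ) : (0 : H) ∈ l1rSpace φ r := by
  refine ⟨1, one_pos, fun p _ => ⟨0, mem_dictSpan_iff.2 (Submodule.zero_mem _), ?_, ?_⟩⟩
  · rw [dictNorm_zero]; exact zero_le_one
  · rw [sub_zero, norm_zero]; positivity

lemma exists_approx_of_mem_interpClass {f : H} {q r R δ : ℝ} (hf : f ∈ interpClass φ q r R)
    (hR : 0 < R) (hδ : 0 < δ) (hp : 1 ≤ p) :
    ∃ h ∈ LinearMap.range (dictMap φ p), ∃ A B : ℝ, 0 ≤ A ∧ 0 ≤ B ∧ dictNorm φ p h ≤ B ∧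
      ‖f - h‖ ≤ A + B * (p : ℝ) ^ (-r) ∧ A + δ * B ≤ 2 * (R * δ ^ (2 * (1 / q - 1 / 2))) := by
  have hT : 0 < R * δ ^ (2 * (1 / q - 1 / 2)) := by positivity
  have : Nonempty (l1rSpace φ r) := ⟨⟨0, zero_mem_l1rSpace φ r⟩⟩
  obtain ⟨⟨g, hg⟩, hlt⟩ := exists_lt_of_ciInf_lt
    -- The infima need not be attained; doubling the positive bound leaves room for a near-minimizer
    -- `g` and an admissible constant `B`.
    ((hf δ hδ).trans_lt (lt_two_mul_self hT))
  simp only at hlt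
  set T := R * δ ^ (2 * (1 / q - 1 / 2))
  have hlt' : l1rNorm φ r g < (2 * T - ‖f - g‖) / δ := by
    rw [lt_div_iff₀ hδ]; linarith
  obtain ⟨B, ⟨hB0, hB⟩, hBlt⟩ := exists_lt_of_csInf_lt (s := {C | IsL1rBound φ r g C}) hg hlt'
  obtain ⟨h, hh, hhB, hgh⟩ := hB p hp
  refine ⟨h, mem_dictSpan_iff.1 hh, ‖f - g‖, B, norm_nonneg _, hB0.le, hhB, ?_, ?_⟩
  · calc ‖f - h‖ = ‖(f - g) + (g - h)‖ := by congr 1; abel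
      _ ≤ ‖f - g‖ + ‖g - h‖ := norm_add_le _ _
      _ ≤ _ := by gcongr
  · rw [lt_div_iff₀ hδ] at hBlt
    linarith

/-- At `δ = 1` and `p = 1` the factor `p^{-r}` is 1, so both `‖f - h‖` and `‖h‖` are at most `2R`.
-/
lemma norm_le_of_mem_interpClass {f : H} {q r R : ℝ} (hf : f ∈ interpClass φ q r R)
    (hφ : ∀ j, ‖φ j‖ ≤ 1) (hR : 0 < R) : ‖f‖ ≤ 4 * R := by
  obtain ⟨h, hh, A, B, hA, hB, hN, hfh, hAB⟩ :=
    exists_approx_of_mem_interpClass (p := 1) hf hR one_pos le_rfl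
  have h1 := norm_le_dictNorm hφ hh
  have h2 : ‖f‖ ≤ ‖f - h‖ + ‖h‖ := by simpa using norm_add_le (f - h) h
  simp only [Nat.cast_one, Real.one_rpow, mul_one, one_mul] at hfh hAB
  linarith

end Approximation

/-! ### Real exponent computations, made polynomial by taking logarithms -/

section Rates

lemma exists_eq_exp {x : ℝ} (hx : 0 < x) : ∃ a, x = Real.exp a :=
  ⟨Real.log x, (Real.exp_log hx).symm⟩

/-- The value `δ = (εl/R)^{q/2}` solves `T = εl/δ`, so both error terms equal the claimed rate. The
upper bound on `R/ε` says exactly `p^{-r} ≤ δ`; the lower one makes the rate dominate `ε²`. -/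
lemma rate_intermediate {q r R ε l p : ℝ} (hq1 : 1 < q) (hq2 : q < 2) (hR : 0 < R)
    (hε : 0 < ε) (hl : 1 ≤ l) (hp : 0 < p) (h1 : l ^ ((q - 1) / q) ≤ R * ε⁻¹)
    (h2 : R * ε⁻¹ ≤ p ^ (2 * r / q) * l) :
    p ^ (-r) ≤ (ε * l / R) ^ (q / 2) ∧
      (R * ((ε * l / R) ^ (q / 2)) ^ (2 * (1 / q - 1 / 2))) ^ 2 = R ^ q * (ε * l) ^ (2 - q) ∧
      ε * l * (R * ((ε * l / R) ^ (q / 2)) ^ (2 * (1 / q - 1 / 2))) / (ε * l / R) ^ (q / 2) =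
        R ^ q * (ε * l) ^ (2 - q) ∧
      ε ^ 2 ≤ R ^ q * (ε * l) ^ (2 - q) := by
  have hl0 : 0 < l := by linarith
  have hq0 : 0 < q := by linarith
  obtain ⟨a, rfl⟩ := exists_eq_exp hR
  obtain ⟨e, rfl⟩ := exists_eq_exp hε
  obtain ⟨b, rfl⟩ := exists_eq_exp hl0
  obtain ⟨s, rfl⟩ := exists_eq_exp hp
  simp only [← Real.exp_neg, ← Real.exp_add, ← Real.exp_sub, ← Real.exp_mul, ← Real.exp_nat_mul,
    Real.exp_le_exp, Real.one_le_exp_iff, Real.exp_eq_exp] at *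
  refine ⟨?_, ?_, ?_, ?_⟩
  · have h3 : s * (2 * r / q) * q = 2 * (s * r) := by field_simp
    nlinarith
  · push_cast; field_simp; ring
  · field_simp; ring
  · have h3 : b * ((q - 1) / q) * q = b * (q - 1) := by field_simp
    push_cast
    nlinarith

lemma rate_large {q r R ε l p : ℝ} (hq1 : 1 < q) (hq2 : q < 2) (hr : 0 < r) (hR : 0 < R)
    (hε : 0 < ε) (hl : 1 ≤ l) (hp : 1 ≤ p) (h : p ^ (2 * r / q) * l < R * ε⁻¹) :
    (R * (p ^ (-r)) ^ (2 * (1 / q - 1 / 2))) ^ 2 ≤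
        (R * p ^ (-r)) ^ (2 * q / (2 - q)) * (ε * l) ^ (4 * (1 - q) / (2 - q)) ∧
      ε * l * (R * (p ^ (-r)) ^ (2 * (1 / q - 1 / 2))) / p ^ (-r) ≤
        (R * p ^ (-r)) ^ (2 * q / (2 - q)) * (ε * l) ^ (4 * (1 - q) / (2 - q)) ∧
      ε ^ 2 ≤ (R * p ^ (-r)) ^ (2 * q / (2 - q)) * (ε * l) ^ (4 * (1 - q) / (2 - q)) := by
  have hl0 : 0 < l := by linarith
  have hp0 : 0 < p := by linarith
  have hq0 : 0 < q := by linarith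
  have hq3 : 0 < 2 - q := by linarith
  obtain ⟨a, rfl⟩ := exists_eq_exp hR
  obtain ⟨e, rfl⟩ := exists_eq_exp hε
  obtain ⟨b, rfl⟩ := exists_eq_exp hl0
  obtain ⟨s, rfl⟩ := exists_eq_exp hp0
  simp only [← Real.exp_neg, ← Real.exp_add, ← Real.exp_sub, ← Real.exp_mul, ← Real.exp_nat_mul,
    Real.exp_le_exp, Real.exp_lt_exp, Real.one_le_exp_iff] at *
  have hsr : 0 ≤ s * r := by positivity
  have hdiv : s * (2 * r / q) = 2 * (s * r / q) := by ring
  have hexp : s * -r * (2 * (1 / q - 1 / 2)) = s * r - 2 * (s * r / q) := by ring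
  -- The log of the target rate is `2 log T` plus a positive multiple of the gap in the regime
  -- condition. The same gap gives `εl/δ ≤ T`, which handles the other two bounds.
  have hV : (a + s * -r) * (2 * q / (2 - q)) + (e + b) * (4 * (1 - q) / (2 - q)) =
      2 * (a + s * -r * (2 * (1 / q - 1 / 2))) +
        4 * (q - 1) / (2 - q) * (a - 2 * (s * r / q) - e - b) := by
    field_simp; ring
  have hpos : 0 ≤ 4 * (q - 1) / (2 - q) * (a - 2 * (s * r / q) - e - b) := by
    have h4 : 0 ≤ q - 1 := by linarith
    have h5 : 0 ≤ a - 2 * (s * r / q) - e - b := by linarith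
    positivity
  have hd : 0 ≤ s * r / q := by positivity
  rw [hV, hexp]
  push_cast
  refine ⟨?_, ?_, ?_⟩ <;> linarith

lemma rate_small {q R ε l : ℝ} (hq1 : 1 < q) (hq2 : q < 2) (hR : 0 < R)
    (hε : 0 < ε) (hl : 1 ≤ l) (h : R * ε⁻¹ < l ^ ((q - 1) / q)) : R ^ 2 ≤ ε ^ 2 * l := by
  have hl0 : 0 < l := by linarith
  have hq0 : 0 < q := by linarith
  obtain ⟨a, rfl⟩ := exists_eq_exp hR
  obtain ⟨e, rfl⟩ := exists_eq_exp hε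
  obtain ⟨b, rfl⟩ := exists_eq_exp hl0
  simp only [← Real.exp_neg, ← Real.exp_add, ← Real.exp_mul, ← Real.exp_nat_mul,
    Real.exp_le_exp, Real.exp_lt_exp, Real.one_le_exp_iff] at *
  have h3 : (q - 1) / q ≤ 1 / 2 := by
    rw [div_le_iff₀ hq0]; linarith
  have h4 := mul_le_mul_of_nonneg_left h3 hl
  push_cast
  linarith

end Rates

/-! ### From the oracle inequality to the rates -/

section LassoRates

variable {H : Type*} [NormedAddCommGroup H] [InnerProductSpace ℝ H]
  {Ω : Type*} [MeasurableSpace Ω] {P : Measure Ω} [IsProbabilityMeasure P] {W : H → Ω → ℝ}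
  {φ : ℕ → H} {p : ℕ} {f : H} {ε : ℝ} {fhat : Ω → H}

lemma lasso_risk_le (hW : IsIsonormal W P)
    (hlin : ∀ᵐ ω ∂P, IsLinearOnDict φ p (fun g => W g ω)) (hφ : ∀ j, ‖φ j‖ ≤ 1)
    (hε : 0 < ε) (hp : 1 ≤ p)
    (hL : IsLasso P (observation f ε W) φ p (lassoParam ε p) fhat) {q r R δ V : ℝ}
    (hf : f ∈ interpClass φ q r R) (hR : 0 < R) (hδ : 0 < δ) (hpδ : (p : ℝ) ^ (-r) ≤ δ)
    (h1 : (R * δ ^ (2 * (1 / q - 1 / 2))) ^ 2 ≤ V)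
    (h2 : ε * (√(Real.log p) + 1) * (R * δ ^ (2 * (1 / q - 1 / 2))) / δ ≤ V)
    (h3 : ε ^ 2 ≤ V) :
    ∫ ω, ‖f - fhat ω‖ ^ 2 ∂P ≤ 112 * V := by
  obtain ⟨h, hh, A, B, hA, hB, hN, hfh, hAB⟩ := exists_approx_of_mem_interpClass hf hR hδ hp
  have horacle := (lasso_oracle hW hlin hφ hε hp hL).2 h hh
  set T := R * δ ^ (2 * (1 / q - 1 / 2))
  have hl : 0 ≤ ε * (√(Real.log p) + 1) := by positivity
  have h4 : ‖f - h‖ ≤ 2 * T := by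
    have := mul_le_mul_of_nonneg_left hpδ hB
    linarith
  have h5 : ‖f - h‖ ^ 2 ≤ 4 * T ^ 2 := by
    calc ‖f - h‖ ^ 2 ≤ (2 * T) ^ 2 := by gcongr
      _ = _ := by ring
  have h6 : dictNorm φ p h ≤ 2 * T / δ := by
    rw [le_div_iff₀ hδ]
    nlinarith
  have h7 : lassoParam ε p * dictNorm φ p h ≤ 8 * V := by
    calc lassoParam ε p * dictNorm φ p h
        = 4 * (ε * (√(Real.log p) + 1)) * dictNorm φ p h := by unfold lassoParam; ring
      _ ≤ 4 * (ε * (√(Real.log p) + 1)) * (2 * T / δ) := by gcongr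
      _ = 8 * (ε * (√(Real.log p) + 1) * T / δ) := by ring
      _ ≤ _ := by gcongr
  linarith [sq_nonneg T]

end LassoRates

theorem proposition5p6 (q : ℝ) (hq1 : 1 < q) (hq2 : q < 2) :
    ∃ C : ℝ, 0 < C ∧
      ∀ (H : Type*) [NormedAddCommGroup H] [InnerProductSpace ℝ H] [CompleteSpace H]
        [TopologicalSpace.SeparableSpace H]
        (Ω : Type*) [MeasurableSpace Ω] (P : Measure Ω) [IsProbabilityMeasure P]
        (W : H → Ω → ℝ) (φ : ℕ → H) (f : H) (ε r R : ℝ),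
        IsIsonormal W P →
        -- the sample paths of `W` are almost surely linear on the span of the dictionary
        (∀ p : ℕ, ∀ᵐ ω ∂P, ∀ θ : Fin p → ℝ,
          W (dictComb φ p θ) ω = ∑ j : Fin p, θ j * W (φ j) ω) →
        (∀ j, ‖φ j‖ ≤ 1) →
        0 < ε → 0 < r → 0 < R →
        f ∈ interpClass φ q r R →
        ∀ p : ℕ, 1 ≤ p →
        ∀ fhat : Ω → H, IsLasso P (observation f ε W) φ p (lassoParam ε p) fhat →
          Integrable (fun ω => ‖f - fhat ω‖ ^ 2) P ∧
          ((√(Real.log p) + 1) ^ ((q - 1) / q) ≤ R * ε⁻¹ →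
            R * ε⁻¹ ≤ (p : ℝ) ^ (2 * r / q) * (√(Real.log p) + 1) →
            ∫ ω, ‖f - fhat ω‖ ^ 2 ∂P ≤
              C * R ^ q * (ε * (√(Real.log p) + 1)) ^ (2 - q)) ∧
          (R * ε⁻¹ > (p : ℝ) ^ (2 * r / q) * (√(Real.log p) + 1) →
            ∫ ω, ‖f - fhat ω‖ ^ 2 ∂P ≤
              C * (R * (p : ℝ) ^ (-r)) ^ (2 * q / (2 - q)) *
                (ε * (√(Real.log p) + 1)) ^ (4 * (1 - q) / (2 - q))) ∧
          (R * ε⁻¹ < (√(Real.log p) + 1) ^ ((q - 1) / q) →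
            ∫ ω, ‖f - fhat ω‖ ^ 2 ∂P ≤
              C * ε ^ 2 * (√(Real.log p) + 1)) := by
  -- The case `h = 0` dictates the constant: `3·(4R)² + 64ε²` with `R² ≤ ε²(√ln p + 1)` gives `48 +
  -- 64`. The other regimes need only `12 + 16 + 64`.
  refine ⟨112, by norm_num, ?_⟩
  intro H _ _ _ _ Ω _ P _ W φ f ε r R hW hlin hφ hε hr hR hf p hp fhat hL
  have hl : 1 ≤ √(Real.log p) + 1 := by linarith [Real.sqrt_nonneg (Real.log p)]
  have hp1 : (1 : ℝ) ≤ p := by exact_mod_cast hp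
  have hp0 : (0 : ℝ) < p := by linarith
  have horacle := lasso_oracle hW (hlin p) hφ hε hp hL
  refine ⟨horacle.1, fun h1 h2 => ?_, fun h => ?_, fun h => ?_⟩
  · obtain ⟨e1, e2, e3, e4⟩ := rate_intermediate hq1 hq2 hR hε hl hp0 h1 h2
    rw [mul_assoc]
    exact lasso_risk_le hW (hlin p) hφ hε hp hL hf hR (by positivity) e1 e2.le e3.le e4
  · obtain ⟨e1, e2, e3⟩ := rate_large hq1 hq2 hr hR hε hl hp1 h
    rw [mul_assoc]
    exact lasso_risk_le hW (hlin p) hφ hε hp hL hf hR (by positivity) le_rfl e1 e2 e3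
  · have h1 := rate_small hq1 hq2 hR hε hl h
    have h2 := horacle.2 0 (Submodule.zero_mem _)
    have h3 := norm_le_of_mem_interpClass hf hφ hR
    rw [sub_zero, dictNorm_zero, mul_zero, add_zero] at h2
    have h4 : ‖f‖ ^ 2 ≤ (4 * R) ^ 2 := by gcongr
    have h5 : ε ^ 2 ≤ ε ^ 2 * (√(Real.log p) + 1) := le_mul_of_one_le_right (by positivity) hl
    linarith
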